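/- Let $\Omega\subset\mathbb R^n$ be a bounded polyhedral domain and let $\mathcal T$ be a simplicial triangulation of $\Omega$, i.e. a finite simplicial complex in $\mathbb R^n$ in which every simplex is a subsimplex of an $n$-simplex and whose simplices cover exactly $\overline\Omega$. Let $\Delta_m(\mathcal T)$ be the set of its $m$-dimensional subsimplices, identify $\mathcal T$ with $\Delta_n(\mathcal T)$, and put $\Delta(\mathcal T)=\bigcup_{m=0}^n\Delta_m(\mathcal T)$. For $f\in\Delta(\mathcal T)$ let $\mathcal T_f$ be the set of all $n$-simplices of $\mathcal T$ that contain $f$, and let $\Omega_f=\bigcup_{S\in\mathcal T_f}S$ be the macroelement of $f$. For a vertex $x_j$ let $\lambda_j$ be its barycentric coordinate function, extended by zero outside $\Omega_{x_j}$. Let $f=[x_0,\dots,x_m]\in\Delta_m(\mathcal T)$ and write $\lambda_f=(\lambda_0,\dots,\lambda_m):\overline\Omega\to\mathcal S_m^c=\{\lambda\in\mathbb R^{m+1}:\lambda_j\ge0,\ \sum_j\lambda_j\le1\}$. For $\lambda\in\mathcal S_m^c$ let $b(\lambda)=1-\sum_j\lambda_j$, and for $I\subset\{0,\dots,m\}$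 let $P_I\lambda$ be the vector obtained from $\lambda$ by replacing the components with index in $I$ by $0$. For $m<n$ define $$A_fv(\lambda)=\frac1{|\Omega_f|}\int_{\Omega_f}v\Big(\sum_{j=0}^m\lambda_jx_j+b(\lambda)y\Big)\,dy,\qquad K_mw(\lambda)=\sum_{I\subset\{0,\dots,m\}}(-1)^{|I|}\,\frac{b(\lambda)}{b(P_I\lambda)}\,w(P_I\lambda),$$ where the term with $I=\emptyset$ is $w(\lambda)$ and a term with $I\neq\emptyset$ and $b(P_I\lambda)=0$ is read as $0$, and put $C_fv=(K_m\circ A_f)v(\lambda_f(\cdot))$. For $m=n$ let $C_fv$ be $v$ on $f$ and $0$ elsewhere. The components $B_f$ of the bubble transform are defined recursively on the dimension by $$B_fu=C_fu^m\quad\text{for } f\in\Delta_m(\mathcal T),\qquad u^m=u-\sum_{j<m}\ \sum_{g\in\Delta_j(\mathcal T)}B_gu .$$ **Theorem.** Let $r\ge1$, and let $u$ be a continuous function on $\overline\Omega$ whose restriction to each $n$-simplex of $\mathcal T$ is a polynomial of degree at most $r$. Then, for every $f\in\Delta(\mathcal T)$, the function $B_fu$ is continuous on $\overline\Omega$, its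 restriction to each $n$-simplex in $\mathcal T_f$ is a polynomial of degree at most $r$, and $B_fu$ vanishes identically on $\overline\Omega\setminus\Omega_f$. -/

import Mathlib

open MeasureTheory
open scoped Classical

noncomputable section

namespace BubbleTransform

/-- Euclidean `n`-space. -/
abbrev Space (n : ℕ) : Type := EuclideanSpace ℝ (Fin n)

/-- A simplicial triangulation of a set `Ω` in Euclidean `n`-space: a finite geometric simplicial
complex (simplices are given by their vertex sets) in which every simplex is a subsimplex of an
`n`-simplex, and whose simplices cover exactly the closure of `Ω`. -/
structure Triangulation (n : ℕ) (Ω : Set (Space n)) extends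
    Geometry.SimplicialComplex ℝ (Space n) where
  finite_faces : faces.Finite
  pure : ∀ s ∈ faces, ∃ t ∈ faces, s ⊆ t ∧ t.card = n + 1
  space_eq_closure : (⋃ s ∈ faces, convexHull ℝ (s : Set (Space n))) = closure Ω

variable {n : ℕ} {Ω : Set (Space n)}

/-- The set of all `m`-dimensional subsimplices of the triangulation. -/
def Triangulation.simplices (T : Triangulation n Ω) (m : ℕ) : Finset (Finset (Space n)) :=
  T.finite_faces.toFinset.filter fun s => s.card = m + 1

/-- The elements of `T_f`: the `n`-simplices of the triangulation that contain `f`. -/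
def Triangulation.star (T : Triangulation n Ω) (f : Finset (Space n)) :
    Finset (Finset (Space n)) :=
  (T.simplices n).filter fun s => f ⊆ s

/-- The macroelement `Ω_f`, the union of the `n`-simplices that contain `f`. -/
def Triangulation.macroelement (T : Triangulation n Ω) (f : Finset (Space n)) :
    Set (Space n) :=
  ⋃ s ∈ T.star f, convexHull ℝ (s : Set (Space n))

/-- The restriction of `v` to the set `S` is a polynomial of degree at most `r`. -/
def IsPolyOn (r : ℕ) (S : Set (Space n)) (v : Space n → ℝ) : Prop :=
  ∃ p : MvPolynomial (Fin n) ℝ, p.totalDegree ≤ r ∧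
    ∀ x ∈ S, v x = MvPolynomial.eval (fun i => x i) p

/-- `v` is a continuous piecewise polynomial of degree at most `r` on the triangulation. Only the
values of `v` on the closure of `Ω` matter. -/
def Triangulation.ContPiecewisePoly (T : Triangulation n Ω) (r : ℕ) (v : Space n → ℝ) : Prop :=
  ContinuousOn v (closure Ω) ∧
    ∀ s ∈ T.simplices n, IsPolyOn r (convexHull ℝ (s : Set (Space n))) v

/-- `v` is continuous on the closure of `Ω`, its restriction to `Ω_f` is a piecewise polynomial of
degree at most `r` on the triangulation `T_f` of `Ω_f`, and `v` is identically zero outside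
`Ω_f`. -/
def Triangulation.ContPiecewisePolyZero (T : Triangulation n Ω) (r : ℕ)
    (f : Finset (Space n)) (v : Space n → ℝ) : Prop :=
  ContinuousOn v (closure Ω) ∧
    (∀ s ∈ T.star f, IsPolyOn r (convexHull ℝ (s : Set (Space n))) v) ∧
    ∀ x ∈ closure Ω \ T.macroelement f, v x = 0

/-- The numbers `w q`, `q ∈ s`, are the barycentric coordinates of a point `x` of the simplex with
vertex set `s`. -/
def IsBarycentric (s : Finset (Space n)) (x : Space n) (w : Space n → ℝ) : Prop :=
  (∀ q ∈ s, 0 ≤ w q) ∧ ∑ q ∈ s, w q = 1 ∧ ∑ q ∈ s, w q • q = x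

/-- The barycentric coordinate function of the vertex `p`, extended by zero outside the
macroelement of `p`. On a simplex which contains `p` it is the usual barycentric coordinate; see
`Triangulation.baryCoord_eq` for the independence of the choices. -/
def Triangulation.baryCoord (T : Triangulation n Ω) (p x : Space n) : ℝ :=
  if h : ∃ sw : Finset (Space n) × (Space n → ℝ),
      sw.1 ∈ T.faces ∧ p ∈ sw.1 ∧ IsBarycentric sw.1 x sw.2
  then h.choose.2 p else 0

/-- The vector `λ_f(x)` of barycentric coordinates associated with the vertices of `f`. -/
def Triangulation.baryVec (T : Triangulation n Ω) (f : Finset (Space n)) (x : Space n) :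
    f → ℝ :=
  fun p => T.baryCoord p x

section Cutoff

variable {ι : Type} [Fintype ι]

/-- `b(λ) = 1 - ∑ λ_i`, the barycentric coordinate of the origin. -/
def originCoord (l : ι → ℝ) : ℝ := 1 - ∑ i, l i

/-- The projection `P_I`, which replaces the components with index in `I` by zero. -/
def proj (I : Finset ι) (l : ι → ℝ) : ι → ℝ := fun i => if i ∈ I then 0 else l i

/-- The operator `K^I`, that is, `w ↦ (b(λ) / b(P_I λ)) w(P_I λ)`; for `I = ∅` the quotient is
identically one and `K^I w = w`. -/
def cutoffTerm (I : Finset ι) (w : (ι → ℝ) → ℝ) (l : ι → ℝ) : ℝ :=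
  if I = ∅ then w l else originCoord l / originCoord (proj I l) * w (proj I l)

/-- The trace preserving cut-off operator `K = ∑_I (-1)^|I| K^I`. -/
def cutoff (w : (ι → ℝ) → ℝ) (l : ι → ℝ) : ℝ :=
  ∑ I : Finset ι, (-1) ^ I.card * cutoffTerm I w l

end Cutoff

/-- The map `G(λ, y) = ∑ λ_j x_j + b(λ) y`, where the `x_j` are the vertices of `f`. -/
def contraction (f : Finset (Space n)) (l : f → ℝ) (y : Space n) : Space n :=
  ∑ p : f, l p • (p : Space n) + originCoord l • y

/-- The local averaging operator `A_f`: the mean value over `y ∈ Ω_f` of `v(G(λ, y))`. -/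
def Triangulation.average (T : Triangulation n Ω) (f : Finset (Space n)) (v : Space n → ℝ)
    (l : f → ℝ) : ℝ :=
  ⨍ y in T.macroelement f, v (contraction f l y)

/-- The operator `C_f`: the restriction to `f` (extended by zero) if `f` is an `n`-simplex, and
`(K ∘ A_f) v (λ_f(·))` if `dim f < n`. -/
def Triangulation.localCutoff (T : Triangulation n Ω) (f : Finset (Space n))
    (v : Space n → ℝ) : Space n → ℝ :=
  if f.card = n + 1 then (convexHull ℝ (f : Set (Space n))).indicator v
  else fun x => cutoff (T.average f v) (T.baryVec f x)

/-- The functions `u^m`: `u^0 = u` and `u^(m+1) = u^m - ∑ C_f u^m`, where the sum is over all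
subsimplices `f` of dimension `m`. -/
def Triangulation.residual (T : Triangulation n Ω) (u : Space n → ℝ) : ℕ → Space n → ℝ
  | 0 => u
  | m + 1 => T.residual u m - ∑ f ∈ T.simplices m, T.localCutoff f (T.residual u m)

/-- The component `B_f` of the bubble transform: `B_f u = C_f u^m` with `m = dim f`. -/
def Triangulation.bubble (T : Triangulation n Ω) (f : Finset (Space n)) (u : Space n → ℝ) :
    Space n → ℝ :=
  T.localCutoff f (T.residual u (f.card - 1))

/-- The residuals satisfy `u^m = u - ∑ B_g u`, summed over all `g` of dimension less than `m`. -/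
theorem Triangulation.residual_eq (T : Triangulation n Ω) (u : Space n → ℝ) (m : ℕ) :
    T.residual u m = u - ∑ j ∈ Finset.range m, ∑ g ∈ T.simplices j, T.bubble g u := by
  induction m with
  | zero => simp [Triangulation.residual]
  | succ m ih =>
    have h : ∑ g ∈ T.simplices m, T.localCutoff g (T.residual u m)
        = ∑ g ∈ T.simplices m, T.bubble g u := by
      refine Finset.sum_congr rfl fun g hg => ?_
      have hc : g.card = m + 1 := (Finset.mem_filter.1 hg).2
      simp [Triangulation.bubble, hc]
    rw [Triangulation.residual, h, Finset.sum_range_succ, ih]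
    abel

/-- The barycentric coordinate functions are well defined: on every simplex of the triangulation
they are given by the barycentric coordinates with respect to that simplex. -/
theorem Triangulation.baryCoord_eq (T : Triangulation n Ω) {s : Finset (Space n)}
    (hs : s ∈ T.faces) {x : Space n} {w : Space n → ℝ} (hw : IsBarycentric s x w)
    (p : Space n) : T.baryCoord p x = if p ∈ s then w p else 0 := by
  have uniq : ∀ {s : Finset (Space n)}, s ∈ T.faces → ∀ {x : Space n} {w w' : Space n → ℝ},
      (∑ q ∈ s, w q = 1) → (∑ q ∈ s, w' q = 1) → (∑ q ∈ s, w q • q = x) →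
      (∑ q ∈ s, w' q • q = x) → ∀ q ∈ s, w q = w' q := by
    intro s hs x w w' h1 h1' h2 h2' q hq
    have hi := T.indep hs
    rw [affineIndependent_iff] at hi
    have := hi Finset.univ (fun i => w i - w' i)
      (by
        rw [Finset.sum_coe_sort s (fun i => w i - w' i), Finset.sum_sub_distrib, h1, h1', sub_self])
      (by
        rw [Finset.sum_coe_sort s (fun i => (w i - w' i) • i)]
        simp only [sub_smul, Finset.sum_sub_distrib, h2, h2', sub_self])
      ⟨q, hq⟩ (Finset.mem_univ _)
    exact sub_eq_zero.1 this
  have ext : ∀ {s t : Finset (Space n)}, s ∈ T.faces → ∀ {x : Space n} {w v : Space n → ℝ},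
      IsBarycentric s x w → IsBarycentric (s ∩ t) x v →
      ∀ q ∈ s, w q = if q ∈ t then v q else 0 := by
    intro s t hs x w v hw hv
    refine uniq hs hw.2.1 ?_ hw.2.2 ?_
    · rw [← hv.2.1, ← Finset.sum_filter, Finset.filter_mem_eq_inter]
    · rw [← hv.2.2]
      simp only [ite_smul, zero_smul]
      rw [← Finset.sum_filter, Finset.filter_mem_eq_inter]
  have inter : ∀ {s t : Finset (Space n)}, s ∈ T.faces → t ∈ T.faces →
      ∀ {x : Space n} {w w' : Space n → ℝ}, IsBarycentric s x w → IsBarycentric t x w' →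
      ∃ v, IsBarycentric (s ∩ t) x v := by
    intro s t hs ht x w w' hw hw'
    have m1 : x ∈ convexHull ℝ (s : Set (Space n)) := by
      rw [Finset.convexHull_eq]
      exact ⟨w, hw.1, hw.2.1, by rw [Finset.centerMass_eq_of_sum_1 _ _ hw.2.1]; exact hw.2.2⟩
    have m2 : x ∈ convexHull ℝ (t : Set (Space n)) := by
      rw [Finset.convexHull_eq]
      exact ⟨w', hw'.1, hw'.2.1, by rw [Finset.centerMass_eq_of_sum_1 _ _ hw'.2.1]; exact hw'.2.2⟩
    have m3 := T.inter_subset_convexHull hs ht ⟨m1, m2⟩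
    rw [← Finset.coe_inter, Finset.convexHull_eq] at m3
    obtain ⟨v, h0, h1, h2⟩ := m3
    rw [Finset.centerMass_eq_of_sum_1 _ _ h1] at h2
    exact ⟨v, h0, h1, h2⟩
  unfold Triangulation.baryCoord
  by_cases h : ∃ sw : Finset (Space n) × (Space n → ℝ),
      sw.1 ∈ T.faces ∧ p ∈ sw.1 ∧ IsBarycentric sw.1 x sw.2
  · rw [dif_pos h]
    obtain ⟨ht, hpt, hw'⟩ := h.choose_spec
    obtain ⟨v, hv⟩ := inter ht hs hw' hw
    rw [ext ht hw' hv p hpt]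
    split_ifs with hps
    · rw [ext hs hw (by rwa [Finset.inter_comm] at hv) p hps, if_pos hpt]
    · rfl
  · rw [dif_neg h, if_neg]
    exact fun hps => h ⟨(s, w), hs, hps, hw⟩

end BubbleTransform

end

/-! Induction on `m` (`residual_spec`) shows that `u^m` stays a continuous piecewise polynomial of
degree at most `r` and vanishes on every simplex of dimension less than `m`. What is needed is the
effect of `C_f` on such a function `v`, where `dim f = m < n`.

For fixed `y` in a simplex of the star, `G(·, y)` is affine with values in that simplex, so `v(G(·,
y))` is a polynomial of degree at most `r`; averaging over `y` preserves this. On the face `b = 0`,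
`A_f v` is the trace of `v` on `f`, hence zero on the boundary of that face. For `I ≠ ∅`, `A_f v ∘
P_I` therefore vanishes where `b ∘ P_I` does, so it is divisible by it; the factor `b` restores the
lost degree (`PolyDegOn.mul_div_originCoord_proj`). Composing with `λ_f`, affine on each simplex,
keeps the degree.

If some `λ_j = 0`, the terms of `I` and `I ∪ {j}` cancel (`cutoff_eq_zero`), so `C_f v` vanishes on
every simplex not containing `f`. On `f` itself `C_f v = v`. Subtracting all `C_f u^m` with `dim f =
m` thus kills the next skeleton. -/

namespace BubbleTransform

/-! ### Polynomial functions on a set: substitution, integration, degree -/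

section PolynomialTools

/-- An integral of elements of a finite-dimensional space of functions belongs to the space. -/
theorem integral_mem_of_finiteDimensional {X Y : Type*} [MeasurableSpace Y] {μ : Measure Y}
    (V : Submodule ℝ (X → ℝ)) [FiniteDimensional ℝ V] {F : X → Y → ℝ}
    (hF : ∀ᵐ y ∂μ, (fun x => F x y) ∈ V) (hint : ∀ x, Integrable (F x) μ) :
    (fun x => ∫ y, F x y ∂μ) ∈ V := by
  -- Point evaluations span the dual, since only zero is killed by all of them. Each coordinate on
  -- `V` is thus a finite combination of evaluations, which makes the coordinates of `F · y`
  -- integrable in `y`.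
  let ev : X → Module.Dual ℝ V := fun x => (LinearMap.proj x).comp V.subtype
  have hspan : Submodule.span ℝ (Set.range ev) = ⊤ := by
    by_contra h
    obtain ⟨φ, hφ, hker⟩ := Submodule.exists_le_ker_of_lt_top _ (lt_top_iff_ne_top.2 h)
    obtain ⟨v, rfl⟩ := (Module.evalEquiv ℝ V).surjective φ
    refine hφ ?_
    have hv : v = 0 := by
      ext x
      have := hker (Submodule.subset_span (Set.mem_range_self x) :
        ev x ∈ Submodule.span ℝ (Set.range ev))
      simpa [ev] using this
    rw [hv, map_zero]
  let b := Module.finBasis ℝ V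
  have hcoord : ∀ i, ∃ c : X →₀ ℝ, (c.sum fun x a => a • ev x) = b.coord i := fun i =>
    Finsupp.mem_span_range_iff_exists_finsupp.1 (by rw [hspan]; exact Submodule.mem_top)
  choose c hc using hcoord
  let κ : Fin (Module.finrank ℝ V) → Y → ℝ := fun i y => ∑ x ∈ (c i).support, c i x * F x y
  have hκ : ∀ i, Integrable (κ i) μ := fun i =>
    integrable_finsetSum _ fun x _ => (hint x).const_mul _
  have key : ∀ x, ∫ y, F x y ∂μ = ∑ i, (∫ y, κ i y ∂μ) * (b i : X → ℝ) x := by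
    intro x
    have h1 : ∀ᵐ y ∂μ, F x y = ∑ i, κ i y * (b i : X → ℝ) x := by
      filter_upwards [hF] with y hy
      have h2 := congrArg (fun v : V => (v : X → ℝ) x) (b.sum_repr ⟨_, hy⟩)
      simp only [Submodule.coe_sum, Submodule.coe_smul, Finset.sum_apply, Pi.smul_apply,
        smul_eq_mul] at h2
      rw [← h2]
      refine Finset.sum_congr rfl fun i _ => ?_
      have h3 : b.repr ⟨_, hy⟩ i = κ i y := by
        rw [← b.coord_apply, ← hc i]
        simp [Finsupp.sum, κ, ev]
      rw [h3]
    rw [integral_congr_ae h1, integral_finsetSum _ fun i _ => (hκ i).mul_const _]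
    exact Finset.sum_congr rfl fun i _ => integral_mul_const _ _
  have : (fun x => ∫ y, F x y ∂μ) = ∑ i, (∫ y, κ i y ∂μ) • (b i : X → ℝ) := by
    ext x
    simp [key x]
  rw [this]
  exact V.sum_mem fun i _ => V.smul_mem _ (b i).2

variable {ι κ : Type*}

/-- On the set `D`, the function `w` is a polynomial of degree at most `r`. -/
def PolyDegOn (r : ℕ) (D : Set (ι → ℝ)) (w : (ι → ℝ) → ℝ) : Prop :=
  ∃ p : MvPolynomial ι ℝ, p.totalDegree ≤ r ∧ ∀ x ∈ D, w x = MvPolynomial.eval x p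

theorem PolyDegOn.sum {r : ℕ} {D : Set (ι → ℝ)} {α : Type*} (s : Finset α)
    {w : α → (ι → ℝ) → ℝ} (h : ∀ a ∈ s, PolyDegOn r D (w a)) :
    PolyDegOn r D (fun x => ∑ a ∈ s, w a x) := by
  choose! p hp hw using h
  exact ⟨∑ a ∈ s, p a, MvPolynomial.totalDegree_finsetSum_le hp, fun x hx => by
    rw [map_sum]; exact Finset.sum_congr rfl fun a ha => hw a ha x hx⟩

theorem PolyDegOn.const_mul {r : ℕ} {D : Set (ι → ℝ)} {w : (ι → ℝ) → ℝ} (c : ℝ)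
    (h : PolyDegOn r D w) : PolyDegOn r D (fun x => c * w x) := by
  obtain ⟨p, hp, hw⟩ := h
  exact ⟨c • p, (MvPolynomial.totalDegree_smul_le _ _).trans hp, fun x hx => by
    simp [hw x hx, MvPolynomial.smul_eval]⟩

/-- Substituting polynomials of degree at most one does not raise the degree. -/
theorem totalDegree_aeval_le (g : ι → MvPolynomial κ ℝ) (hg : ∀ i, (g i).totalDegree ≤ 1)
    (p : MvPolynomial ι ℝ) : (MvPolynomial.aeval g p).totalDegree ≤ p.totalDegree := by
  rw [MvPolynomial.aeval_def, MvPolynomial.eval₂_eq]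
  refine MvPolynomial.totalDegree_finsetSum_le fun d hd => ?_
  refine (MvPolynomial.totalDegree_mul _ _).trans ?_
  rw [MvPolynomial.algebraMap_eq, MvPolynomial.totalDegree_C, zero_add]
  refine (MvPolynomial.totalDegree_finsetProd _ _).trans ?_
  refine le_trans (Finset.sum_le_sum fun i _ => ?_) (MvPolynomial.le_totalDegree hd)
  exact (MvPolynomial.totalDegree_pow _ _).trans
    ((Nat.mul_le_mul_left _ (hg i)).trans (by rw [mul_one]))

theorem eval_aeval (g : ι → MvPolynomial κ ℝ) (x : κ → ℝ) (p : MvPolynomial ι ℝ) :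
    MvPolynomial.eval x (MvPolynomial.aeval g p) =
      MvPolynomial.eval (fun i => MvPolynomial.eval x (g i)) p :=
  (MvPolynomial.eval_assoc g x p).symm

theorem PolyDegOn.comp {r : ℕ} {D : Set (ι → ℝ)} {E : Set (κ → ℝ)} {w : (ι → ℝ) → ℝ}
    (h : PolyDegOn r D w) {g : (κ → ℝ) → ι → ℝ} (hg : ∀ i, PolyDegOn 1 E fun x => g x i)
    (hmaps : Set.MapsTo g E D) : PolyDegOn r E (w ∘ g) := by
  obtain ⟨p, hp, hw⟩ := h
  choose q hq hgq using hg
  refine ⟨MvPolynomial.aeval q p, (totalDegree_aeval_le q hq p).trans hp, fun x hx => ?_⟩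
  rw [Function.comp_apply, hw _ (hmaps hx), eval_aeval]
  congr 2
  ext i
  exact hgq i x hx

theorem PolyDegOn.integral [Finite ι] {r : ℕ} {D : Set (ι → ℝ)} {Y : Type*} [MeasurableSpace Y]
    {μ : Measure Y} {F : (ι → ℝ) → Y → ℝ} (hF : ∀ᵐ y ∂μ, PolyDegOn r D fun x => F x y)
    (hint : ∀ x ∈ D, Integrable (F x) μ) : PolyDegOn r D (fun x => ∫ y, F x y ∂μ) := by
  let L : MvPolynomial ι ℝ →ₗ[ℝ] (D → ℝ) :=
    LinearMap.pi fun x => (MvPolynomial.aeval x.1).toLinearMap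
  have h := integral_mem_of_finiteDimensional (μ := μ)
    ((MvPolynomial.restrictTotalDegree ι ℝ r).map L) (F := fun x y => F x.1 y) (by
      filter_upwards [hF] with y ⟨p, hp, hw⟩
      refine ⟨p, (MvPolynomial.mem_restrictTotalDegree _ _ _).2 hp, ?_⟩
      ext x
      simp [L, hw x.1 x.2, MvPolynomial.aeval_eq_eval]) fun x => hint x.1 x.2
  obtain ⟨p, hp, hw⟩ := h
  refine ⟨p, (MvPolynomial.mem_restrictTotalDegree _ _ _).1 hp, fun x hx => ?_⟩
  have := congrFun hw ⟨x, hx⟩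
  simpa [L, MvPolynomial.aeval_eq_eval] using this.symm

theorem totalDegree_one_sub_sum_X (J : Finset ι) :
    (1 - ∑ i ∈ J, MvPolynomial.X i : MvPolynomial ι ℝ).totalDegree ≤ 1 := by
  refine (MvPolynomial.totalDegree_sub _ _).trans (max_le (by simp) ?_)
  exact MvPolynomial.totalDegree_finsetSum_le fun i _ => by simp

/-- This lower bound on the degree of the divisor is what makes a quotient by `b ∘ P_I` lose a
degree. -/
theorem one_le_totalDegree_one_sub_sum_X {J : Finset ι} {j : ι} (hj : j ∈ J) :
    1 ≤ (1 - ∑ i ∈ J, MvPolynomial.X i : MvPolynomial ι ℝ).totalDegree := by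
  have : Finsupp.single j 1 ∈ (1 - ∑ i ∈ J, MvPolynomial.X i : MvPolynomial ι ℝ).support := by
    rw [MvPolynomial.mem_support_iff, MvPolynomial.coeff_sub, MvPolynomial.coeff_sum]
    have h1 : ∀ i, MvPolynomial.coeff (Finsupp.single j 1) (MvPolynomial.X i : MvPolynomial ι ℝ)
        = if i = j then 1 else 0 := by
      intro i
      rw [MvPolynomial.coeff_X]
      simp [Finsupp.single_left_inj]
    simp [h1, hj, MvPolynomial.coeff_one, eq_comm (a := (0 : ι →₀ ℕ))]
  simpa using MvPolynomial.le_totalDegree this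

end PolynomialTools

/-! ### The cut-off operator on the corner simplex -/

section CutoffTools

variable {ι : Type} [Fintype ι]

/-- The set `S_m^c` of the values of `λ_f`. -/
def cornerSimplex (ι : Type) [Fintype ι] : Set (ι → ℝ) := {l | (∀ i, 0 ≤ l i) ∧ ∑ i, l i ≤ 1}

theorem originCoord_nonneg {l : ι → ℝ} (hl : l ∈ cornerSimplex ι) : 0 ≤ originCoord l :=
  sub_nonneg.2 hl.2

theorem proj_mem {l : ι → ℝ} (hl : l ∈ cornerSimplex ι) (I : Finset ι) :
    proj I l ∈ cornerSimplex ι := by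
  refine ⟨fun i => ?_, le_trans (Finset.sum_le_sum fun i _ => ?_) hl.2⟩ <;>
  · have := hl.1 i
    unfold proj
    split_ifs <;> simp [this]

theorem originCoord_le_proj {l : ι → ℝ} (hl : l ∈ cornerSimplex ι) (I : Finset ι) :
    originCoord l ≤ originCoord (proj I l) := by
  refine sub_le_sub_left (Finset.sum_le_sum fun i _ => ?_) _
  have := hl.1 i
  unfold proj
  split_ifs <;> simp [this]

theorem cutoff_eq_of_originCoord_eq_zero (w : (ι → ℝ) → ℝ) {l : ι → ℝ}
    (hl : originCoord l = 0) : cutoff w l = w l := by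
  unfold cutoff
  rw [Finset.sum_eq_single ∅]
  · simp [cutoffTerm]
  · intro I _ hI
    simp [cutoffTerm, hI, hl]
  · simp

/-- The term of `∅` in the cut-off operator has the same form as the others. -/
theorem cutoffTerm_eq {w : (ι → ℝ) → ℝ} {l : ι → ℝ} (h : originCoord l = 0 → w l = 0)
    (I : Finset ι) :
    cutoffTerm I w l = originCoord l / originCoord (proj I l) * w (proj I l) := by
  unfold cutoffTerm
  split_ifs with hI
  · subst hI
    have : proj ∅ l = l := by ext; simp [proj]
    rw [this]
    by_cases h0 : originCoord l = 0
    · simp [h0, h h0]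
    · rw [div_self h0, one_mul]
  · rfl

/-- When `l j = 0`, the projections `P_I l` and `P_{I ∪ {j}} l` agree and the signs are opposite, so
the terms cancel in pairs. The hypothesis on `w` only serves `I = ∅`, where the quotient may be `0 /
0`. -/
theorem cutoff_eq_zero {w : (ι → ℝ) → ℝ} {l : ι → ℝ} (h : originCoord l = 0 → w l = 0)
    {j : ι} (hj : l j = 0) : cutoff w l = 0 := by
  have hproj : ∀ I, j ∉ I → proj (insert j I) l = proj I l := by
    intro I hI
    ext i
    by_cases hi : i = j
    · subst hi; simp [proj, hj]
    · simp [proj, hi]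
  have key : ∀ I, j ∉ I → (-1 : ℝ) ^ I.card * cutoffTerm I w l +
      (-1) ^ (insert j I).card * cutoffTerm (insert j I) w l = 0 := by
    intro I hI
    rw [cutoffTerm_eq h, cutoffTerm_eq h, hproj I hI, Finset.card_insert_of_notMem hI, pow_succ]
    ring
  unfold cutoff
  refine Finset.sum_involution (fun I _ => if j ∈ I then I.erase j else insert j I) ?_ ?_ ?_ ?_
  · intro I _
    split_ifs with hI
    · have := key (I.erase j) (Finset.notMem_erase j I)
      rw [Finset.insert_erase hI] at this
      rw [add_comm]
      exact this
    · exact key I hI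
  · intro I _ _
    split_ifs with hI
    · exact fun h => Finset.notMem_erase j I (h.symm ▸ hI : j ∈ I.erase j)
    · exact fun h => hI (h ▸ Finset.mem_insert_self j I)
  · simp
  · intro I _
    by_cases hI : j ∈ I
    · simp [hI]
    · simp [hI]

theorem originCoord_eq_eval (l : ι → ℝ) :
    originCoord l = MvPolynomial.eval l (1 - ∑ i, MvPolynomial.X i : MvPolynomial ι ℝ) := by
  simp [originCoord]

/-- A polynomial `p` on the corner simplex which vanishes on a face `∑ λ_i = 1` is, up to the
factor `b(λ)/b(P_I λ)`, a polynomial whose degree is not larger. -/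
theorem PolyDegOn.mul_div_originCoord_proj {r : ℕ} (hr : 1 ≤ r) {w : (ι → ℝ) → ℝ}
    (hw : PolyDegOn r (cornerSimplex ι) w) (I : Finset ι)
    (h0 : ∀ l ∈ cornerSimplex ι, (∀ i ∈ I, l i = 0) → originCoord l = 0 → w l = 0) :
    PolyDegOn r (cornerSimplex ι)
      (fun l => originCoord l / originCoord (proj I l) * w (proj I l)) := by
  obtain ⟨p, hp, hwp⟩ := hw
  -- Here the function is `b(l) w(0)`, of degree one whatever `w` is; this is where `1 ≤ r` enters.
  by_cases hI : I = Finset.univ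
  · subst hI
    have h1 : ∀ l : ι → ℝ, proj Finset.univ l = 0 := fun l => by ext; simp [proj]
    refine ⟨w 0 • (1 - ∑ i, MvPolynomial.X i), (MvPolynomial.totalDegree_smul_le _ _).trans
      ((totalDegree_one_sub_sum_X _).trans hr), fun l _ => ?_⟩
    have h2 : originCoord (0 : ι → ℝ) = 1 := by simp [originCoord]
    simp only [h1]
    rw [MvPolynomial.smul_eval, ← originCoord_eq_eval, h2, div_one, mul_comm]
  obtain ⟨j, hj⟩ : ∃ j, j ∉ I := by
    by_contra! h
    exact hI (Finset.eq_univ_of_forall h)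
  -- `b` is the origin coordinate of `P_I l`, `g₁` is `P_I`, and `g₂` moves the mass `b` onto the
  -- coordinate `j ∉ I`, landing on the face where `w` vanishes. As `g₁ ≡ g₂` modulo `b`, the
  -- difference `p ∘ g₁ - p ∘ g₂` is divisible by `b`, and it equals `w ∘ P_I` on the corner
  -- simplex.
  let b : MvPolynomial ι ℝ := 1 - ∑ i ∈ Finset.univ.filter (· ∉ I), MvPolynomial.X i
  let g₁ : ι → MvPolynomial ι ℝ := fun i => if i ∈ I then 0 else MvPolynomial.X i
  let g₂ : ι → MvPolynomial ι ℝ := fun i => if i = j then MvPolynomial.X i + b else g₁ i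
  have hb : ∀ l, MvPolynomial.eval l b = originCoord (proj I l) := by
    intro l
    simp only [b, originCoord, proj, map_sub, map_one, map_sum, MvPolynomial.eval_X]
    rw [Finset.sum_filter]
    congr 1
    exact Finset.sum_congr rfl fun i _ => by by_cases h : i ∈ I <;> simp [h]
  have hb1 : b.totalDegree ≤ 1 := totalDegree_one_sub_sum_X _
  have hb2 : 1 ≤ b.totalDegree := one_le_totalDegree_one_sub_sum_X (j := j) (by simp [hj])
  have hg₁ : ∀ i, (g₁ i).totalDegree ≤ 1 := fun i => by
    simp only [g₁]; split_ifs <;> simp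
  have hg₂ : ∀ i, (g₂ i).totalDegree ≤ 1 := fun i => by
    simp only [g₂]
    split_ifs
    · exact (MvPolynomial.totalDegree_add _ _).trans (max_le (by simp) hb1)
    · exact hg₁ i
  have hdvd : ∀ q : MvPolynomial ι ℝ, b ∣ MvPolynomial.aeval g₁ q - MvPolynomial.aeval g₂ q := by
    intro q
    induction q using MvPolynomial.induction_on with
    | C a => simp
    | add p q hp hq =>
      rw [map_add, map_add, add_sub_add_comm]
      exact dvd_add hp hq
    | mul_X q i hq =>
      rw [map_mul, map_mul, MvPolynomial.aeval_X, MvPolynomial.aeval_X]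
      refine dvd_mul_sub_mul hq ?_
      by_cases h : i = j
      · subst h; simp [g₂, g₁, hj]
      · simp [g₂, h]
  obtain ⟨q, hq⟩ := hdvd p
  have hb0 : (1 - ∑ i, MvPolynomial.X i : MvPolynomial ι ℝ).totalDegree ≤ 1 :=
    totalDegree_one_sub_sum_X _
  refine ⟨(1 - ∑ i, MvPolynomial.X i) * q, ?_, fun l hl => ?_⟩
  · by_cases hq0 : q = 0
    · simp [hq0]
    have hbne : b ≠ 0 := by
      intro h
      rw [h, MvPolynomial.totalDegree_zero] at hb2
      omega
    have h1 := MvPolynomial.totalDegree_mul_of_isDomain hbne hq0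
    rw [← hq] at h1
    have h2 := MvPolynomial.totalDegree_sub (MvPolynomial.aeval g₁ p) (MvPolynomial.aeval g₂ p)
    have h3 := totalDegree_aeval_le g₁ hg₁ p
    have h4 := totalDegree_aeval_le g₂ hg₂ p
    have h5 := MvPolynomial.totalDegree_mul (1 - ∑ i, MvPolynomial.X i : MvPolynomial ι ℝ) q
    have h6 := max_le h3 h4
    omega
  · have hPl := proj_mem hl I
    have hbl := originCoord_nonneg hPl
    let l' : ι → ℝ := fun i => proj I l i + if i = j then originCoord (proj I l) else 0
    have hsum : originCoord l' = 0 := by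
      simp only [originCoord, l', Finset.sum_add_distrib, Finset.sum_ite_eq', Finset.mem_univ,
        if_true]
      ring
    have hl' : l' ∈ cornerSimplex ι := by
      refine ⟨fun i => add_nonneg (hPl.1 i) ?_, ?_⟩
      · split_ifs
        · exact hbl
        · exact le_rfl
      · exact (sub_eq_zero.1 hsum).symm.le
    have hw' : w l' = 0 := by
      refine h0 _ hl' (fun i hi => ?_) hsum
      have : i ≠ j := fun h => hj (h ▸ hi)
      simp [l', proj, hi, this]
    have e1 : (fun i => MvPolynomial.eval l (g₁ i)) = proj I l := by
      ext i
      simp only [g₁, proj]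
      split_ifs <;> simp
    have e2 : (fun i => MvPolynomial.eval l (g₂ i)) = l' := by
      ext i
      by_cases h : i = j
      · subst h; simp [g₂, l', hb, proj, hj]
      · simpa [g₂, l', h] using congrFun e1 i
    have h1 := congrArg (MvPolynomial.eval l) hq
    rw [map_sub, eval_aeval, eval_aeval, e1, e2, ← hwp _ hPl, ← hwp _ hl', hw', sub_zero, map_mul,
      hb] at h1
    simp only [map_mul, ← originCoord_eq_eval, h1]
    -- At a zero of the denominator, `0 ≤ b(l) ≤ b(P_I l)` forces `b(l) = 0`, so both sides vanish.
    by_cases hz : originCoord (proj I l) = 0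
    · have : originCoord l = 0 :=
        le_antisymm (hz ▸ originCoord_le_proj hl I) (originCoord_nonneg hl)
      simp [this]
    · field_simp

theorem PolyDegOn.cutoff {r : ℕ} (hr : 1 ≤ r) {w : (ι → ℝ) → ℝ}
    (hw : PolyDegOn r (cornerSimplex ι) w)
    (h0 : ∀ l ∈ cornerSimplex ι, ∀ i, l i = 0 → originCoord l = 0 → w l = 0) :
    PolyDegOn r (cornerSimplex ι) (cutoff w) := by
  refine PolyDegOn.sum Finset.univ fun I _ => PolyDegOn.const_mul _ ?_
  by_cases hI : I = ∅
  · subst hI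
    have : cutoffTerm ∅ w = w := by ext; simp [cutoffTerm]
    rwa [this]
  · obtain ⟨i, hi⟩ := Finset.nonempty_iff_ne_empty.2 hI
    have := hw.mul_div_originCoord_proj hr I fun l hl hl' => h0 l hl i (hl' i hi)
    unfold cutoffTerm
    simpa [hI] using this

end CutoffTools

/-! ### Polynomials on subsets of Euclidean space -/

variable {n : ℕ} {Ω : Set (Space n)}

theorem exists_isBarycentric {s : Finset (Space n)} {x : Space n}
    (hx : x ∈ convexHull ℝ (s : Set (Space n))) : ∃ w, IsBarycentric s x w := by
  rw [Finset.convexHull_eq] at hx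
  obtain ⟨w, h0, h1, h2⟩ := hx
  rw [Finset.centerMass_eq_of_sum_1 _ _ h1] at h2
  exact ⟨w, h0, h1, h2⟩

theorem isPolyOn_iff {r : ℕ} {S : Set (Space n)} {v : Space n → ℝ} :
    IsPolyOn r S v ↔ PolyDegOn r {z : Fin n → ℝ | WithLp.toLp 2 z ∈ S}
      (fun z => v (WithLp.toLp 2 z)) := by
  constructor
  · rintro ⟨p, hp, hv⟩
    exact ⟨p, hp, fun z hz => hv _ hz⟩
  · rintro ⟨p, hp, hv⟩
    exact ⟨p, hp, fun x hx => hv (fun i => x i) hx⟩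

theorem IsPolyOn.sub {r : ℕ} {S : Set (Space n)} {v w : Space n → ℝ} (hv : IsPolyOn r S v)
    (hw : IsPolyOn r S w) : IsPolyOn r S (v - w) := by
  obtain ⟨p, hp, hv⟩ := hv
  obtain ⟨q, hq, hw⟩ := hw
  exact ⟨p - q, (MvPolynomial.totalDegree_sub _ _).trans (max_le hp hq), fun x hx => by
    simp [hv x hx, hw x hx]⟩

theorem IsPolyOn.sum {r : ℕ} {S : Set (Space n)} {α : Type*} (A : Finset α)
    {v : α → Space n → ℝ} (hv : ∀ a ∈ A, IsPolyOn r S (v a)) : IsPolyOn r S (∑ a ∈ A, v a) := by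
  choose! p hp hw using hv
  exact ⟨∑ a ∈ A, p a, MvPolynomial.totalDegree_finsetSum_le hp, fun x hx => by
    rw [map_sum, Finset.sum_apply]; exact Finset.sum_congr rfl fun a ha => hw a ha x hx⟩

theorem isPolyOn_of_eq_zero {r : ℕ} {S : Set (Space n)} {v : Space n → ℝ}
    (h : ∀ x ∈ S, v x = 0) : IsPolyOn r S v :=
  ⟨0, by simp, fun x hx => by simp [h x hx]⟩

theorem IsPolyOn.continuousOn {r : ℕ} {S : Set (Space n)} {v : Space n → ℝ}
    (hv : IsPolyOn r S v) : ContinuousOn v S := by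
  obtain ⟨p, -, hv⟩ := hv
  refine ContinuousOn.congr (Continuous.continuousOn ?_) hv
  exact (MvPolynomial.continuous_eval p).comp (by fun_prop)

/-- An affine function is a polynomial of degree at most one. -/
theorem isPolyOn_affineMap (a : Space n →ᵃ[ℝ] ℝ) (S : Set (Space n)) : IsPolyOn 1 S a := by
  refine ⟨∑ i, MvPolynomial.C (a.linear (EuclideanSpace.single i 1)) * MvPolynomial.X i +
    MvPolynomial.C (a 0), ?_, fun x _ => ?_⟩
  · refine (MvPolynomial.totalDegree_add _ _).trans (max_le ?_ (by simp))
    refine MvPolynomial.totalDegree_finsetSum_le fun i _ => ?_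
    exact (MvPolynomial.totalDegree_mul _ _).trans (by simp)
  · have h1 : a x = a.linear x + a 0 := by
      have := congrFun a.decomp x
      simpa using this
    have h2 : x = ∑ i, x i • EuclideanSpace.single i (1 : ℝ) := by
      ext j
      simp [Finset.sum_apply, Pi.single_apply]
    rw [h1]
    conv_lhs => rw [h2]
    simp [map_sum, mul_comm]

/-! ### Geometry of the triangulation, barycentric coordinates and averages -/

namespace Triangulation

variable (T : Triangulation n Ω)

theorem mem_simplices {T : Triangulation n Ω} {m : ℕ} {s : Finset (Space n)} :
    s ∈ T.simplices m ↔ s ∈ T.faces ∧ s.card = m + 1 := by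
  simp [simplices]

theorem mem_star {T : Triangulation n Ω} {f s : Finset (Space n)} :
    s ∈ T.star f ↔ (s ∈ T.faces ∧ s.card = n + 1) ∧ f ⊆ s := by
  simp [star, mem_simplices]

theorem closure_eq : closure Ω = ⋃ s ∈ T.simplices n, convexHull ℝ (s : Set (Space n)) := by
  rw [← T.space_eq_closure]
  ext x
  simp only [Set.mem_iUnion, exists_prop]
  constructor
  · rintro ⟨s, hs, hx⟩
    obtain ⟨t, ht, hst, hc⟩ := T.pure s hs
    exact ⟨t, mem_simplices.2 ⟨ht, hc⟩, convexHull_mono (by exact_mod_cast hst) hx⟩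
  · rintro ⟨s, hs, hx⟩
    exact ⟨s, (mem_simplices.1 hs).1, hx⟩

theorem star_nonempty {f : Finset (Space n)} (hf : f ∈ T.faces) : (T.star f).Nonempty := by
  obtain ⟨t, ht, hst, hc⟩ := T.pure f hf
  exact ⟨t, mem_star.2 ⟨⟨ht, hc⟩, hst⟩⟩

theorem isCompact_convexHull (s : Finset (Space n)) :
    IsCompact (convexHull ℝ (s : Set (Space n))) :=
  s.finite_toSet.isCompact_convexHull (𝕜 := ℝ)

theorem isCompact_macroelement (f : Finset (Space n)) : IsCompact (T.macroelement f) :=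
  (T.star f).isCompact_biUnion fun s _ => isCompact_convexHull s

theorem macroelement_subset (f : Finset (Space n)) : T.macroelement f ⊆ closure Ω := by
  rw [T.closure_eq]
  exact Set.biUnion_subset_biUnion_left fun s hs => (Finset.mem_filter.1 hs).1

theorem affineSpan_eq_top {s : Finset (Space n)} (hs : s ∈ T.simplices n) :
    affineSpan ℝ (Set.range ((↑) : s → Space n)) = ⊤ := by
  rw [mem_simplices] at hs
  rw [(T.indep hs.1).affineSpan_eq_top_iff_card_eq_finrank_add_one]
  simp [hs.2]

theorem volume_macroelement_ne_zero {f : Finset (Space n)} (hf : f ∈ T.faces) :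
    volume (T.macroelement f) ≠ 0 := by
  obtain ⟨s, hs⟩ := T.star_nonempty hf
  have h1 := T.affineSpan_eq_top (Finset.mem_filter.1 hs).1
  rw [Subtype.range_coe_subtype] at h1
  have h2 : (interior (convexHull ℝ (s : Set (Space n)))).Nonempty :=
    interior_convexHull_nonempty_iff_affineSpan_eq_top.2 h1
  have h3 : interior (convexHull ℝ (s : Set (Space n))) ⊆ T.macroelement f :=
    interior_subset.trans (Set.subset_biUnion_of_mem (u := fun s : Finset (Space n) =>
      convexHull ℝ (s : Set (Space n))) hs)
  exact ((isOpen_interior.measure_pos volume h2).trans_le (measure_mono h3)).ne'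

theorem baryCoord_of_mem {s : Finset (Space n)} (hs : s ∈ T.faces) {x : Space n}
    (hx : x ∈ convexHull ℝ (s : Set (Space n))) :
    IsBarycentric s x (fun p => T.baryCoord p x) ∧ ∀ p ∉ s, T.baryCoord p x = 0 := by
  obtain ⟨w, hw⟩ := exists_isBarycentric hx
  have h := T.baryCoord_eq hs hw
  have h' : ∀ q ∈ s, T.baryCoord q x = w q := fun q hq => by rw [h, if_pos hq]
  refine ⟨⟨fun q hq => (hw.1 q hq).trans_eq (h' q hq).symm, ?_, ?_⟩, fun p hp => by rw [h, if_neg hp]⟩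
  · rw [← hw.2.1]; exact Finset.sum_congr rfl h'
  · exact (Finset.sum_congr rfl fun q hq => congrArg (· • q) (h' q hq)).trans hw.2.2

theorem baryCoord_nonneg {x : Space n} (hx : x ∈ closure Ω) (p : Space n) :
    0 ≤ T.baryCoord p x := by
  rw [T.closure_eq] at hx
  simp only [Set.mem_iUnion, exists_prop] at hx
  obtain ⟨s, hs, hx⟩ := hx
  obtain ⟨h1, h2⟩ := T.baryCoord_of_mem (mem_simplices.1 hs).1 hx
  by_cases hp : p ∈ s
  · exact h1.1 p hp
  · exact (h2 p hp).ge

theorem baryVec_mem (f : Finset (Space n)) {x : Space n} (hx : x ∈ closure Ω) :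
    T.baryVec f x ∈ cornerSimplex f := by
  refine ⟨fun p => T.baryCoord_nonneg hx p, ?_⟩
  have hx' := hx
  rw [T.closure_eq] at hx'
  simp only [Set.mem_iUnion, exists_prop] at hx'
  obtain ⟨s, hs, hxs⟩ := hx'
  obtain ⟨h1, h2⟩ := T.baryCoord_of_mem (mem_simplices.1 hs).1 hxs
  change ∑ p : f, T.baryCoord p x ≤ 1
  rw [Finset.sum_coe_sort f (fun p => T.baryCoord p x), ← h1.2.1]
  rw [← Finset.sum_subset (Finset.inter_subset_left : f ∩ s ⊆ f) fun p hp hps =>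
    h2 p fun h => hps (Finset.mem_inter.2 ⟨hp, h⟩)]
  exact Finset.sum_le_sum_of_subset_of_nonneg Finset.inter_subset_right fun p hp _ => h1.1 p hp

theorem sum_baryVec {f : Finset (Space n)} (hf : f ∈ T.faces) {x : Space n}
    (hx : x ∈ convexHull ℝ (f : Set (Space n))) :
    originCoord (T.baryVec f x) = 0 ∧ ∑ p : f, T.baryVec f x p • (p : Space n) = x := by
  obtain ⟨h1, -⟩ := T.baryCoord_of_mem hf hx
  constructor
  · change 1 - ∑ p : f, T.baryCoord p x = 0
    rw [Finset.sum_coe_sort f (fun p => T.baryCoord p x), h1.2.1, sub_self]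
  · change ∑ p : f, T.baryCoord p x • (p : Space n) = x
    rw [Finset.sum_coe_sort f (fun p => T.baryCoord p x • p), h1.2.2]

theorem isPolyOn_baryCoord {s : Finset (Space n)} (hs : s ∈ T.simplices n) (p : Space n) :
    IsPolyOn 1 (convexHull ℝ (s : Set (Space n))) (T.baryCoord p) := by
  have hs' := (mem_simplices.1 hs).1
  by_cases hp : p ∈ s
  · let b : AffineBasis s ℝ (Space n) := ⟨_, T.indep hs', T.affineSpan_eq_top hs⟩
    obtain ⟨q, hq, hqe⟩ := isPolyOn_affineMap (b.coord ⟨p, hp⟩) (convexHull ℝ (s : Set (Space n)))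
    refine ⟨q, hq, fun x hx => ?_⟩
    obtain ⟨h1, -⟩ := T.baryCoord_of_mem hs' hx
    rw [← hqe x hx]
    have hsum : ∑ i : s, T.baryCoord i x = 1 := by
      rw [Finset.sum_coe_sort s (fun p => T.baryCoord p x), h1.2.1]
    have := b.coord_apply_combination_of_mem (Finset.mem_univ ⟨p, hp⟩)
      (w := fun i : s => T.baryCoord i x) hsum
    rw [Finset.affineCombination_eq_linear_combination _ _ _ hsum] at this
    have h2 : ∑ i : s, T.baryCoord i x • b i = x := by
      change ∑ i : s, T.baryCoord i x • (i : Space n) = x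
      rw [Finset.sum_coe_sort s (fun p => T.baryCoord p x • p), h1.2.2]
    rw [h2] at this
    exact this.symm
  · exact isPolyOn_of_eq_zero fun x hx => (T.baryCoord_of_mem hs' hx).2 p hp

/-- Finitely many closed simplices cover the closure, so continuity on each one suffices. -/
theorem continuousOn_of_isPolyOn {r : ℕ} {v : Space n → ℝ}
    (h : ∀ s ∈ T.simplices n, IsPolyOn r (convexHull ℝ (s : Set (Space n))) v) :
    ContinuousOn v (closure Ω) := by
  have h' : closure Ω =
      ⋃ s : T.simplices n, convexHull ℝ ((s : Finset (Space n)) : Set (Space n)) := by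
    ext x
    simp [T.closure_eq]
  rw [h']
  refine (locallyFinite_of_finite _).continuousOn_iUnion (fun s => ?_) fun s => ?_
  · exact (isCompact_convexHull s.1).isClosed
  · exact (h s.1 s.2).continuousOn

theorem contraction_mem {f s : Finset (Space n)} (hfs : f ⊆ s) {l : f → ℝ}
    (hl : l ∈ cornerSimplex f) {y : Space n} (hy : y ∈ convexHull ℝ (s : Set (Space n))) :
    contraction f l y ∈ convexHull ℝ (s : Set (Space n)) := by
  -- A convex combination indexed by `Option f`: `none` stands for `y`, with weight `b(l)`.
  have h := (convex_convexHull ℝ (s : Set (Space n))).sum_mem (t := Finset.univ)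
    (w := fun o : Option f => o.elim (originCoord l) l)
    (z := fun o : Option f => o.elim y (fun p => (p : Space n)))
    (by
      rintro (_ | p) -
      · exact originCoord_nonneg hl
      · exact hl.1 p)
    (by simp [Fintype.sum_option, originCoord])
    (by
      rintro (_ | p) -
      · exact hy
      · exact subset_convexHull ℝ _ (hfs p.2))
  simp only [Fintype.sum_option, Option.elim] at h
  rwa [add_comm] at h

/-- The integrand no longer depends on `y`, and the macroelement has positive finite volume. -/
theorem average_of_originCoord_eq_zero {f : Finset (Space n)} (hf : f ∈ T.faces)
    (v : Space n → ℝ) {l : f → ℝ} (hl : originCoord l = 0) :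
    T.average f v l = v (∑ p : f, l p • (p : Space n)) := by
  unfold average contraction
  simp only [hl, zero_smul, add_zero]
  exact setAverage_const (T.volume_macroelement_ne_zero hf)
    (T.isCompact_macroelement f).measure_lt_top.ne _

theorem polyDegOn_average {r : ℕ} {v : Space n → ℝ} (hv : T.ContPiecewisePoly r v)
    (f : Finset (Space n)) :
    PolyDegOn r (cornerSimplex f) (T.average f v) := by
  have key : PolyDegOn r (cornerSimplex f)
      (fun l => ∫ y in T.macroelement f, v (contraction f l y)) := by
    refine PolyDegOn.integral ?_ fun l hl => ?_
    · refine (ae_restrict_iff' (T.isCompact_macroelement f).measurableSet).2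
        (Filter.Eventually.of_forall fun y hy => ?_)
      simp only [macroelement, Set.mem_iUnion, exists_prop] at hy
      obtain ⟨s, hs, hy⟩ := hy
      have h1 := isPolyOn_iff.1 (hv.2 s (Finset.mem_filter.1 hs).1)
      refine h1.comp (g := fun l => (contraction f l y).ofLp) (fun i => ?_) fun l hl => ?_
      · refine ⟨∑ p : f, MvPolynomial.C ((p : Space n) i) * MvPolynomial.X p +
          MvPolynomial.C (y i) * (1 - ∑ p, MvPolynomial.X p), ?_, fun l _ => ?_⟩
        · refine (MvPolynomial.totalDegree_add _ _).trans (max_le ?_ ?_)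
          · refine MvPolynomial.totalDegree_finsetSum_le fun p _ => ?_
            exact (MvPolynomial.totalDegree_mul _ _).trans (by simp)
          · refine (MvPolynomial.totalDegree_mul _ _).trans ?_
            rw [MvPolynomial.totalDegree_C, zero_add]
            exact totalDegree_one_sub_sum_X _
        · rw [map_add, map_mul, ← originCoord_eq_eval]
          simp [contraction, mul_comm]
      · exact contraction_mem (mem_star.1 hs).2 hl hy
    · refine ContinuousOn.integrableOn_compact (T.isCompact_macroelement f) ?_
      refine ContinuousOn.comp (t := closure Ω) hv.1 ?_ fun y hy => ?_
      · unfold contraction; fun_prop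
      · refine T.macroelement_subset f ?_
        simp only [macroelement, Set.mem_iUnion, exists_prop] at hy ⊢
        obtain ⟨s, hs, hy⟩ := hy
        exact ⟨s, hs, contraction_mem (mem_star.1 hs).2 hl hy⟩
  have h := key.const_mul (volume.real (T.macroelement f))⁻¹
  have : T.average f v = fun l => (volume.real (T.macroelement f))⁻¹ *
      ∫ y in T.macroelement f, v (contraction f l y) := by
    ext l
    rw [average, setAverage_eq, smul_eq_mul]
  rwa [this]

/-! ### Local cut-offs and induction over skeletons -/

/-- The function `v` vanishes on all subsimplices with at most `k` vertices. -/
def VanishesOnSkeleton (k : ℕ) (v : Space n → ℝ) : Prop :=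
  ∀ g ∈ T.faces, g.card ≤ k → ∀ x ∈ convexHull ℝ (g : Set (Space n)), v x = 0

variable {T}

/-- The boundary value of the average on the face `b = 0` vanishes on the boundary of `f`. -/
theorem average_eq_zero {f : Finset (Space n)} (hf : f ∈ T.faces) {v : Space n → ℝ}
    (hv : T.VanishesOnSkeleton (f.card - 1) v) {l : f → ℝ} (hl : l ∈ cornerSimplex f) {p : f}
    (hp : l p = 0) (h0 : originCoord l = 0) : T.average f v l = 0 := by
  rw [T.average_of_originCoord_eq_zero hf v h0]
  have hsum : ∑ q : f, l q = 1 := (sub_eq_zero.1 h0).symm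
  have hmem : ∑ q : f, l q • (q : Space n) ∈
      convexHull ℝ ((f.erase p : Finset (Space n)) : Set (Space n)) := by
    have h := (convex_convexHull ℝ ((f.erase p : Finset (Space n)) : Set (Space n))).sum_mem
      (t := Finset.univ.erase p) (w := l) (z := fun q : f => (q : Space n))
      (fun q _ => hl.1 q)
      (by rw [← hsum]; exact Finset.sum_erase _ hp)
      (fun q hq => subset_convexHull ℝ _ (by
        simp only [Finset.mem_coe, Finset.mem_erase, ne_eq, SetLike.coe_eq_coe]
        exact ⟨(Finset.mem_erase.1 hq).1, q.2⟩))
    rwa [Finset.sum_erase _ (by rw [hp, zero_smul])] at h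
  have hne : (f.erase p).Nonempty := by
    by_contra h
    rw [Finset.not_nonempty_iff_eq_empty] at h
    rw [h] at hmem
    simp at hmem
  exact hv _ (T.down_closed hf (Finset.erase_subset _ _) hne)
    (Finset.card_erase_of_mem p.2).le _ hmem

/-- If `f` is an `n`-simplex, the points in question lie in the proper face `f ∩ g`, where `v`
vanishes. Otherwise a vertex of `f` outside `g` has coordinate zero at `x`, and the cut-off cancels.
-/
theorem localCutoff_eq_zero {f g : Finset (Space n)} (hf : f ∈ T.faces) (hg : g ∈ T.faces)
    (hfg : ¬ f ⊆ g) {v : Space n → ℝ} (hv : T.VanishesOnSkeleton (f.card - 1) v) {x : Space n}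
    (hx : x ∈ convexHull ℝ (g : Set (Space n))) : T.localCutoff f v x = 0 := by
  obtain ⟨p, hpf, hpg⟩ := Finset.not_subset.1 hfg
  unfold localCutoff
  split_ifs with hc
  · by_cases hxf : x ∈ convexHull ℝ (f : Set (Space n))
    · rw [Set.indicator_of_mem hxf]
      have h1 := T.inter_subset_convexHull hf hg ⟨hxf, hx⟩
      rw [← Finset.coe_inter] at h1
      have hne : (f ∩ g).Nonempty := by
        by_contra h
        rw [Finset.not_nonempty_iff_eq_empty] at h
        rw [h] at h1
        simp at h1
      refine hv _ (T.down_closed hf Finset.inter_subset_left hne) ?_ x h1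
      have : (f ∩ g).card < f.card := Finset.card_lt_card
        ⟨Finset.inter_subset_left, fun h => hpg (Finset.mem_inter.1 (h hpf)).2⟩
      omega
    · exact Set.indicator_of_notMem hxf _
  · have h0 : T.baryVec f x ⟨p, hpf⟩ = 0 := (T.baryCoord_of_mem hg hx).2 p hpg
    have hx' : x ∈ closure Ω := by
      rw [← T.space_eq_closure]
      exact Set.mem_biUnion hg hx
    exact cutoff_eq_zero (average_eq_zero hf hv (T.baryVec_mem f hx') h0) h0

theorem localCutoff_eq_self {f : Finset (Space n)} (hf : f ∈ T.faces) (v : Space n → ℝ)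
    {x : Space n} (hx : x ∈ convexHull ℝ (f : Set (Space n))) : T.localCutoff f v x = v x := by
  unfold localCutoff
  split_ifs with hc
  · exact Set.indicator_of_mem hx _
  · obtain ⟨h1, h2⟩ := T.sum_baryVec hf hx
    change cutoff (T.average f v) (T.baryVec f x) = v x
    rw [cutoff_eq_of_originCoord_eq_zero _ h1, T.average_of_originCoord_eq_zero hf v h1, h2]

theorem isPolyOn_localCutoff {r : ℕ} (hr : 1 ≤ r) {f : Finset (Space n)} (hf : f ∈ T.faces)
    {v : Space n → ℝ} (hp : T.ContPiecewisePoly r v) (hv : T.VanishesOnSkeleton (f.card - 1) v)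
    {s : Finset (Space n)} (hs : s ∈ T.simplices n) :
    IsPolyOn r (convexHull ℝ (s : Set (Space n))) (T.localCutoff f v) := by
  have hs' := mem_simplices.1 hs
  by_cases hfs : f ⊆ s
  · by_cases hc : f.card = n + 1
    · obtain rfl : f = s := Finset.eq_of_subset_of_card_le hfs (by rw [hc, hs'.2])
      obtain ⟨q, hq, hvq⟩ := hp.2 f hs
      exact ⟨q, hq, fun x hx => (localCutoff_eq_self hf v hx).trans (hvq x hx)⟩
    · have h := (T.polyDegOn_average hp f).cutoff hr fun l hl i hi h0 =>
        average_eq_zero hf hv hl hi h0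
      unfold localCutoff
      rw [if_neg hc, isPolyOn_iff]
      refine h.comp (g := fun z => T.baryVec f (WithLp.toLp 2 z)) (fun p => ?_) fun z hz => ?_
      · exact isPolyOn_iff.1 (T.isPolyOn_baryCoord hs p)
      · refine T.baryVec_mem f ?_
        rw [T.closure_eq]
        exact Set.mem_biUnion (t := fun s : Finset (Space n) => convexHull ℝ (s : Set (Space n)))
          hs hz
  · exact isPolyOn_of_eq_zero fun x hx => localCutoff_eq_zero hf hs'.1 hfs hv hx

/-- Vanishing on the skeleton is carried along because the polynomial degree of `C_f u^m` depends on
it. The index counts vertices: `m` covers dimensions below `m`. -/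
theorem residual_spec {r : ℕ} (hr : 1 ≤ r) {u : Space n → ℝ} (hu : T.ContPiecewisePoly r u)
    (m : ℕ) : T.ContPiecewisePoly r (T.residual u m) ∧ T.VanishesOnSkeleton m (T.residual u m) := by
  induction m with
  | zero =>
    refine ⟨hu, fun g hg hc => ?_⟩
    rw [Nat.le_zero, Finset.card_eq_zero] at hc
    exact absurd (hc ▸ hg) T.empty_notMem
  | succ m ih =>
    obtain ⟨hp, hv⟩ := ih
    have hvf : ∀ f ∈ T.simplices m, T.VanishesOnSkeleton (f.card - 1) (T.residual u m) := by
      intro f hf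
      rwa [(mem_simplices.1 hf).2, Nat.add_sub_cancel]
    have hpoly : ∀ s ∈ T.simplices n, IsPolyOn r (convexHull ℝ (s : Set (Space n)))
        (T.residual u (m + 1)) := fun s hs =>
      (hp.2 s hs).sub (IsPolyOn.sum _ fun f hf =>
        isPolyOn_localCutoff hr (mem_simplices.1 hf).1 hp (hvf f hf) hs)
    refine ⟨⟨T.continuousOn_of_isPolyOn hpoly, hpoly⟩, fun g hg hc x hx => ?_⟩
    rw [residual, Pi.sub_apply, Finset.sum_apply]
    -- Since `g` has at most `m + 1` vertices, it can contain an `m`-simplex `f` only if it equals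
    -- `f`.
    have hzero : ∀ f ∈ T.simplices m, f ≠ g → T.localCutoff f (T.residual u m) x = 0 := by
      intro f hf hfg
      have hf' := mem_simplices.1 hf
      refine localCutoff_eq_zero hf'.1 hg (fun h => hfg ?_) (hvf f hf) hx
      exact Finset.eq_of_subset_of_card_le h (by omega)
    by_cases hgm : g ∈ T.simplices m
    · rw [Finset.sum_eq_single_of_mem g hgm hzero, localCutoff_eq_self hg _ hx, sub_self]
    · rw [Finset.sum_eq_zero fun f hf => hzero f hf fun h => hgm (h ▸ hf), sub_zero]
      refine hv g hg ?_ x hx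
      have : g.card ≠ m + 1 := fun h => hgm (mem_simplices.2 ⟨hg, h⟩)
      omega

end Triangulation

end BubbleTransform

theorem theorem4p1 {n : ℕ} {Ω : Set (BubbleTransform.Space n)}
    (T : BubbleTransform.Triangulation n Ω) (r : ℕ) (hr : 1 ≤ r)
    (u : BubbleTransform.Space n → ℝ) (hu : T.ContPiecewisePoly r u) :
    ∀ f ∈ T.faces, T.ContPiecewisePolyZero r f (T.bubble f u) := by
  intro f hf
  obtain ⟨hp, hv⟩ := BubbleTransform.Triangulation.residual_spec hr hu (f.card - 1)
  have hpoly := fun s hs =>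
    BubbleTransform.Triangulation.isPolyOn_localCutoff hr hf hp hv (s := s) hs
  refine ⟨T.continuousOn_of_isPolyOn hpoly, fun s hs => hpoly s (Finset.mem_filter.1 hs).1, ?_⟩
  rintro x ⟨hx, hxf⟩
  rw [T.closure_eq] at hx
  simp only [Set.mem_iUnion, exists_prop] at hx
  obtain ⟨s, hs, hx⟩ := hx
  refine BubbleTransform.Triangulation.localCutoff_eq_zero hf
    (BubbleTransform.Triangulation.mem_simplices.1 hs).1 (fun hfs => hxf ?_) hv hx
  exact Set.mem_biUnion (t := fun s : Finset (BubbleTransform.Space n) =>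
    convexHull ℝ (s : Set (BubbleTransform.Space n))) (Finset.mem_filter.2 ⟨hs, hfs⟩) hx
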